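/- Let $\mathcal X$ be a set of datasets with a symmetric neighbouring relation $\sim$ under which some two distinct datasets are neighbours. A mechanism $M$ assigns to each $x\in\mathcal X$ a probability distribution $M(x)$ on an outcome space $\mathcal Y$ (an arbitrary measurable space). $M$ is $(\varepsilon,\delta)$-DP if $\Pr[M(x)\in S]\le e^{\varepsilon}\Pr[M(x')\in S]+\delta$ for all $x\sim x'$ and all events $S$; it is $\varepsilon$-DP if it is $(\varepsilon,0)$-DP. $M$ is $\varepsilon$-bounded range ($\varepsilon$-BR) if $\frac{\Pr[M(x)=y_1]}{\Pr[M(x')=y_1]}\le e^{\varepsilon}\frac{\Pr[M(x)=y_2]}{\Pr[M(x')=y_2]}$ for all $x\sim x'$ and all outcomes $y_1,y_2$; for general outcome spaces this is read as $\Pr[M(x)\in S_1]\Pr[M(x')\in S_2]\le e^{\varepsilon}\Pr[M(x)\in S_2]\Pr[M(x')\in S_1]$ for all events $S_1,S_2$. Let $\mathcal M_{\mathrm{DP}}$ and $\mathcal M_{\mathrm{BR}}$ be the classes of all $\varepsilon$-DP and all $\varepsilon$-BR mechanisms. For classes $\mathcal C_1,\mathcal C_2,\mathcal C_3$ let $(\mathcal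 C_1,\mathcal C_2,\mathcal C_3)$ be the class of adaptive compositions: on input $x$ draw $y_1\sim M_1(x)$, then $y_2\sim M_2(x,y_1)$, then $y_3\sim M_3(x,y_1,y_2)$, and output $(y_1,y_2,y_3)$, where $M_1\in\mathcal C_1$, and $M_2(\cdot,y_1)\in\mathcal C_2$, $M_3(\cdot,y_1,y_2)\in\mathcal C_3$ for all fixed $y_1,y_2$ (and $M_2,M_3$ depend measurably on the earlier outcomes). Put $\delta_{\mathrm{opt}}(M;\varepsilon_g)=\inf\{\delta\ge 0: M\text{ is }(\varepsilon_g,\delta)\text{-DP}\}$ and $\delta_{\mathrm{opt}}(\mathcal C;\varepsilon_g)=\sup_{M\in\mathcal C}\delta_{\mathrm{opt}}(M;\varepsilon_g)$. **Lemma.** Let $\varepsilon>0$ and $\varepsilon_g\ge 0$. (1) If $\varepsilon_g\ge\varepsilon$, then $$\delta_{\mathrm{opt}}(\mathcal M_{\mathrm{BR}},\mathcal M_{\mathrm{BR}},\mathcal M_{\mathrm{DP}};\varepsilon_g)=\delta_{\mathrm{opt}}(\mathcal M_{\mathrm{BR}},\mathcal M_{\mathrm{DP}},\mathcal M_{\mathrm{BR}};\varepsilon_g)=\delta_{\mathrm{opt}}(\mathcal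 M_{\mathrm{DP}},\mathcal M_{\mathrm{BR}},\mathcal M_{\mathrm{BR}};\varepsilon_g).$$ (2) If $\varepsilon_g\le\varepsilon$, let $q_{a,t}=\frac{1-e^{t-a}}{1-e^{-a}}$ and $$x(t)=q_{2\varepsilon,\varepsilon}\Big(q_{\varepsilon,t}\,q_{\varepsilon,\frac{\varepsilon_g-t}{2}}^2(1-e^{-\varepsilon})+(1-q_{\varepsilon,t})\,q_{\varepsilon,\frac{\varepsilon_g+\varepsilon-t}{2}}^2(1-e^{-\varepsilon})\Big),$$ $$y(t)=q_{2\varepsilon,\varepsilon}\Big(q_{\varepsilon,t}(1-e^{\varepsilon_g-\varepsilon-t})+(1-q_{\varepsilon,t})\,q_{\varepsilon,\frac{\varepsilon_g+\varepsilon-t}{2}}^2(1-e^{-\varepsilon})\Big),$$ $$z(t)=(1-q_{2\varepsilon,\varepsilon})\,q_{\varepsilon,t}\,q_{\varepsilon,\varepsilon+\frac{\varepsilon_g-t}{2}}^2(1-e^{-\varepsilon}).$$ Then $$\delta_{\mathrm{opt}}(\mathcal M_{\mathrm{DP}},\mathcal M_{\mathrm{BR}},\mathcal M_{\mathrm{BR}};\varepsilon_g)=\max\Big\{\sup_{t\in[0,\varepsilon_g)}x(t),\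 \sup_{t\in[\varepsilon_g,\varepsilon]}y(t)\Big\}+\sup_{t'\in[\varepsilon_g,\varepsilon]}z(t'),$$ $$\delta_{\mathrm{opt}}(\mathcal M_{\mathrm{BR}},\mathcal M_{\mathrm{DP}},\mathcal M_{\mathrm{BR}};\varepsilon_g)=\max\Big\{\sup_{t\in[0,\varepsilon_g)}x(t),\ \sup_{t\in[\varepsilon_g,\varepsilon]}\big(y(t)+z(t)\big)\Big\},$$ $$\delta_{\mathrm{opt}}(\mathcal M_{\mathrm{BR}},\mathcal M_{\mathrm{BR}},\mathcal M_{\mathrm{DP}};\varepsilon_g)=\max\Big\{\sup_{t\in[0,\varepsilon_g)}x(t),\ \sup_{t\in[\varepsilon_g,\varepsilon]}\big(y(t)+z(t)\big)\Big\},$$ where for $\varepsilon_g=0$ the supremum over the empty set $[0,0)$ is read as $0$ (equivalently, omitted from the maximum). -/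

import Mathlib

open MeasureTheory ProbabilityTheory
open scoped ENNReal

noncomputable section

namespace PrivacyComp

universe u

/-- A class of mechanisms with inputs in `X`: for every outcome space `Y`, a predicate on families
`M : X → Measure Y`, where `M x` is the law of the output of the mechanism on the dataset `x`. -/
abbrev MechClass (X : Type u) : Type (max u 1) :=
  ∀ (Y : Type) [MeasurableSpace Y], (X → Measure Y) → Prop

/-- `(ε, δ)`-differential privacy of `M` for the neighbouring relation `Adj`. -/
def IsDP {X : Type u} (Adj : X → X → Prop) {Y : Type} [MeasurableSpace Y]
    (M : X → Measure Y) (ε δ : ℝ) : Prop :=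
  ∀ x x', Adj x x' → ∀ S : Set Y, MeasurableSet S →
    (M x).real S ≤ Real.exp ε * (M x').real S + δ

/-- `ε`-bounded range: `Pr[M x = y₁] / Pr[M x' = y₁] ≤ e^ε Pr[M x = y₂] / Pr[M x' = y₂]`.
The inequality is cleared of denominators and written for events `S₁, S₂` in place of outcomes, so
that it makes sense for all outcome spaces. For discrete outcomes summing over
`y₁ ∈ S₁`, `y₂ ∈ S₂` shows that this is the condition on outcomes; for laws with densities it is
the condition on the densities (almost everywhere). -/
def IsBR {X : Type u} (Adj : X → X → Prop) {Y : Type} [MeasurableSpace Y]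
    (M : X → Measure Y) (ε : ℝ) : Prop :=
  ∀ x x', Adj x x' → ∀ S₁ S₂ : Set Y, MeasurableSet S₁ → MeasurableSet S₂ →
    (M x).real S₁ * (M x').real S₂ ≤ Real.exp ε * ((M x).real S₂ * (M x').real S₁)

/-- The class of all `ε`-DP mechanisms. -/
def DP {X : Type u} (Adj : X → X → Prop) (ε : ℝ) : MechClass X :=
  fun _ _ M => (∀ x, IsProbabilityMeasure (M x)) ∧ IsDP Adj M ε 0

/-- The class of all `ε`-BR mechanisms. -/
def BR {X : Type u} (Adj : X → X → Prop) (ε : ℝ) : MechClass X :=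
  fun _ _ M => (∀ x, IsProbabilityMeasure (M x)) ∧ IsBR Adj M ε

/-- The class `(C₁, C₂, C₃)` of adaptive compositions: on the dataset `x` one draws
`y₁` from `M₁ x`, then `y₂` from `M₂ x y₁`, then `y₃` from `M₃ x (y₁, y₂)`, and releases
`((y₁, y₂), y₃)`. For all fixed earlier outcomes the next mechanism belongs to its class. -/
inductive Adaptive {X : Type u} (C₁ C₂ C₃ : MechClass X) : MechClass X
  | mk {Y₁ Y₂ Y₃ : Type} [MeasurableSpace Y₁] [MeasurableSpace Y₂] [MeasurableSpace Y₃]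
      (M₁ : X → Measure Y₁) (M₂ : X → Kernel Y₁ Y₂) (M₃ : X → Kernel (Y₁ × Y₂) Y₃)
      (h₁ : C₁ Y₁ M₁)
      (h₂ : ∀ y₁, C₂ Y₂ (fun x => M₂ x y₁))
      (h₃ : ∀ y, C₃ Y₃ (fun x => M₃ x y)) :
      Adaptive C₁ C₂ C₃ ((Y₁ × Y₂) × Y₃) (fun x => (M₁ x ⊗ₘ M₂ x) ⊗ₘ M₃ x)

/-- The optimal `δ` of a single mechanism. -/
def deltaOptMech {X : Type u} (Adj : X → X → Prop) {Y : Type} [MeasurableSpace Y]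
    (M : X → Measure Y) (εg : ℝ) : ℝ :=
  sInf {δ : ℝ | 0 ≤ δ ∧ IsDP Adj M εg δ}

/-- The optimal `δ` of a class of mechanisms: the supremum over all its members. -/
def deltaOpt {X : Type u} (Adj : X → X → Prop) (C : MechClass X) (εg : ℝ) : ℝ :=
  sSup {d : ℝ | ∃ (Y : Type) (_ : MeasurableSpace Y) (M : X → Measure Y),
    C Y M ∧ d = deltaOptMech Adj M εg}

/-- The probability `q_{ε,t}` that generalized randomized response maps `0` to `0`. -/
def q (ε t : ℝ) : ℝ := (1 - Real.exp (t - ε)) / (1 - Real.exp (-ε))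

def xFun (ε εg t : ℝ) : ℝ :=
  q (2 * ε) ε *
    (q ε t * q ε ((εg - t) / 2) ^ 2 * (1 - Real.exp (-ε))
      + (1 - q ε t) * q ε ((εg + ε - t) / 2) ^ 2 * (1 - Real.exp (-ε)))

def yFun (ε εg t : ℝ) : ℝ :=
  q (2 * ε) ε *
    (q ε t * (1 - Real.exp (εg - ε - t))
      + (1 - q ε t) * q ε ((εg + ε - t) / 2) ^ 2 * (1 - Real.exp (-ε)))

def zFun (ε εg t : ℝ) : ℝ :=
  (1 - q (2 * ε) ε) * q ε t * q ε (ε + (εg - t) / 2) ^ 2 * (1 - Real.exp (-ε))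

end PrivacyComp

end

namespace PrivacyComp

universe u

/-! For neighbours with output laws P and Q, track the loss profile s ↦ sup_S (P S - e^s Q S).
Knowing only Q ≤ e^(a-t) P and P ≤ e^t Q, the worst pair is generalized randomized response, a coin
whose outcomes have privacy losses exactly t and t - a. Prepending it to a mechanism with profile f
averages f(s - t) and f(s - t + a), which is `mix`. DP means (a, t) = (2ε, ε); BR means a = ε with t
free in [0, ε].

Hence the optimal δ of an adaptive composition is an iterated supremum of `mix`
(`deltaOpt_adaptive`). The upper bound is `integral_sub_le_mix`, applied stage by stage; the lower
bound, `exists_adaptive`, chooses each coin according to the threshold left by the earlier outcomes.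

What remains is an analysis of two operators. Averages commute (`mix_comm`), so the order of DP and
BR matters only because a supremum over t of a sum of two terms may be smaller than the sum of the
suprema. The two agree when one term does not depend on t. This holds at the last stage for every
threshold (`supMix_br_dp`), and at the first stage for thresholds at least ε
(`supMix_br_dp_br_of_le`). Below ε, DP first lets the next BR stage use separate parameters t and t'
after its two outcomes, while BR first forces a common t: this is the difference between sup y + sup
z and sup (y + z). The closed forms come from the explicit one-stage BR profile (`brLoss_of_mem`).
-/

/-- The supremum of `P S - e ^ s * Q S` over events `S` when `P = Q`. -/
noncomputable def trivialLoss (s : ℝ) : ℝ := max 0 (1 - Real.exp s)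

/-- The effect on a loss profile `f` of prepending generalized randomized response with
privacy losses `t` and `t - a`. -/
noncomputable def mix (a t : ℝ) (f : ℝ → ℝ) (s : ℝ) : ℝ :=
  q a t * f (s - t) + (1 - q a t) * f (s - t + a)

/-- The supremum of `mix a t f s` over the parameters `(a, t)` in `I`. -/
noncomputable def supMix (I : Set (ℝ × ℝ)) (f : ℝ → ℝ) (s : ℝ) : ℝ :=
  sSup ((fun p => mix p.1 p.2 f s) '' I)

/-- The parameters for which generalized randomized response is defined. -/
def validParams : Set (ℝ × ℝ) := {p | 0 < p.1 ∧ 0 ≤ p.2 ∧ p.2 ≤ p.1}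

/-! ### Randomized response weights and the averaging operator -/

theorem one_sub_exp_neg_pos {a : ℝ} (ha : 0 < a) : 0 < 1 - Real.exp (-a) := by
  have : Real.exp (-a) < 1 := by rw [Real.exp_lt_one_iff]; linarith
  linarith

theorem q_nonneg {a t : ℝ} (ha : 0 < a) (hta : t ≤ a) : 0 ≤ q a t := by
  have : Real.exp (t - a) ≤ 1 := by rw [Real.exp_le_one_iff]; linarith
  exact div_nonneg (by linarith) (one_sub_exp_neg_pos ha).le

theorem q_le_one {a t : ℝ} (ha : 0 < a) (ht : 0 ≤ t) : q a t ≤ 1 := by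
  have : Real.exp (-a) ≤ Real.exp (t - a) := by rw [Real.exp_le_exp]; linarith
  rw [q, div_le_one (one_sub_exp_neg_pos ha)]
  linarith

theorem q_mul {a : ℝ} (ha : 0 < a) (t : ℝ) :
    q a t * (1 - Real.exp (-a)) = 1 - Real.exp (t - a) :=
  div_mul_cancel₀ _ (one_sub_exp_neg_pos ha).ne'

/-- Reweighting the two outcomes by their inverse likelihood ratios turns the first response law
into the second, which also has total mass one. -/
theorem q_mul_exp_neg_add {a : ℝ} (ha : 0 < a) (t : ℝ) :
    q a t * Real.exp (-t) + (1 - q a t) * Real.exp (a - t) = 1 := by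
  have h := q_mul ha t
  have e1 : Real.exp (-t) = Real.exp (a - t) * Real.exp (-a) := by
    rw [← Real.exp_add]; ring_nf
  have e2 : Real.exp (a - t) * Real.exp (t - a) = 1 := by
    rw [← Real.exp_add]; simp
  rw [e1]
  linear_combination -Real.exp (a - t) * h + e2

theorem trivialLoss_nonneg (s : ℝ) : 0 ≤ trivialLoss s := le_max_left _ _

theorem trivialLoss_le_one (s : ℝ) : trivialLoss s ≤ 1 :=
  max_le zero_le_one (by linarith [Real.exp_pos s])

theorem mix_mono {a t : ℝ} {f g : ℝ → ℝ} (h : (a, t) ∈ validParams) (hfg : ∀ s, f s ≤ g s)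
    (s : ℝ) : mix a t f s ≤ mix a t g s :=
  add_le_add (mul_le_mul_of_nonneg_left (hfg _) (q_nonneg h.1 h.2.2))
    (mul_le_mul_of_nonneg_left (hfg _) (by linarith [q_le_one h.1 h.2.1]))

theorem mix_const (a t c s : ℝ) : mix a t (fun _ => c) s = c := by
  simp only [mix]; ring

theorem mix_sub_const (a t c : ℝ) (f : ℝ → ℝ) (s : ℝ) :
    mix a t (fun r => f r - c) s = mix a t f s - c := by
  simp only [mix]; ring

theorem mix_nonneg {a t : ℝ} {f : ℝ → ℝ} (h : (a, t) ∈ validParams) (hf : ∀ s, 0 ≤ f s) (s : ℝ) :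
    0 ≤ mix a t f s := by
  simpa [mix_const] using mix_mono (f := fun _ => 0) h hf s

theorem mix_le_one {a t : ℝ} {f : ℝ → ℝ} (h : (a, t) ∈ validParams) (hf : ∀ s, f s ≤ 1) (s : ℝ) :
    mix a t f s ≤ 1 := by
  simpa [mix_const] using mix_mono (g := fun _ => 1) h hf s

theorem bddAbove_mix {I : Set (ℝ × ℝ)} (hI : I ⊆ validParams) {f : ℝ → ℝ} (hf : ∀ s, f s ≤ 1)
    (s : ℝ) : BddAbove ((fun p : ℝ × ℝ => mix p.1 p.2 f s) '' I) := by
  refine ⟨1, ?_⟩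
  rintro _ ⟨p, hp, rfl⟩
  exact mix_le_one (hI hp) hf s

theorem mix_le_supMix {I : Set (ℝ × ℝ)} (hI : I ⊆ validParams) {f : ℝ → ℝ} (hf : ∀ s, f s ≤ 1)
    {p : ℝ × ℝ} (hp : p ∈ I) (s : ℝ) : mix p.1 p.2 f s ≤ supMix I f s :=
  le_csSup (bddAbove_mix hI hf s) ⟨p, hp, rfl⟩

theorem supMix_nonneg {I : Set (ℝ × ℝ)} (hI : I ⊆ validParams) {f : ℝ → ℝ} (hf : ∀ s, 0 ≤ f s)
    (s : ℝ) : 0 ≤ supMix I f s := by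
  apply Real.sSup_nonneg
  rintro _ ⟨p, hp, rfl⟩
  exact mix_nonneg (hI hp) hf s

theorem supMix_le_one {I : Set (ℝ × ℝ)} (hI : I ⊆ validParams) {f : ℝ → ℝ} (hf : ∀ s, f s ≤ 1)
    (s : ℝ) : supMix I f s ≤ 1 := by
  apply Real.sSup_le _ zero_le_one
  rintro _ ⟨p, hp, rfl⟩
  exact mix_le_one (hI hp) hf s

/-! ### The one-stage upper bound -/

theorem integrable_of_unit_interval {Y : Type} [MeasurableSpace Y] (P : Measure Y)
    [IsProbabilityMeasure P] {h : Y → ℝ} (hm : Measurable h) (h0 : ∀ y, 0 ≤ h y)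
    (h1 : ∀ y, h y ≤ 1) : Integrable h P := by
  refine Integrable.of_bound hm.aestronglyMeasurable 1 (ae_of_all _ fun y => ?_)
  rw [Real.norm_eq_abs, abs_of_nonneg (h0 y)]
  exact h1 y

theorem integral_le_mul_integral {Y : Type} [MeasurableSpace Y] {P Q : Measure Y}
    [IsProbabilityMeasure P] [IsProbabilityMeasure Q] {c : ℝ} (hc : 0 ≤ c)
    (hPQ : ∀ S, MeasurableSet S → P.real S ≤ c * Q.real S) {h : Y → ℝ} (h0 : ∀ y, 0 ≤ h y)
    (hQ : Integrable h Q) : ∫ y, h y ∂P ≤ c * ∫ y, h y ∂Q := by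
  have hle : P ≤ ENNReal.ofReal c • Q := by
    rw [Measure.le_iff]
    intro S hS
    rw [Measure.smul_apply, smul_eq_mul, ← ofReal_measureReal, ← ofReal_measureReal (μ := Q),
      ← ENNReal.ofReal_mul hc]
    exact ENNReal.ofReal_le_ofReal (hPQ S hS)
  have := integral_mono_measure hle (ae_of_all _ h0) (hQ.smul_measure ENNReal.ofReal_ne_top)
  rwa [integral_smul_measure, ENNReal.toReal_ofReal hc, smul_eq_mul] at this

/-- Here `h` and `h'` stand for the conditional probabilities of an event under the two datasets
after outcome `y`; they differ because the later stages depend on the dataset. Each of the two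
domination bounds is integrated against a nonnegative function built from `hf`, at the two
thresholds that occur in `mix`. -/
theorem integral_sub_le_mix {Y : Type} [MeasurableSpace Y] {P Q : Measure Y}
    [IsProbabilityMeasure P] [IsProbabilityMeasure Q] {a t : ℝ} (ha : 0 < a)
    (hlow : ∀ S, MeasurableSet S → Q.real S ≤ Real.exp (a - t) * P.real S)
    (hup : ∀ S, MeasurableSet S → P.real S ≤ Real.exp t * Q.real S)
    {h h' : Y → ℝ} (hm : Measurable h) (hm' : Measurable h')
    (h0 : ∀ y, 0 ≤ h y) (h1 : ∀ y, h y ≤ 1) (h0' : ∀ y, 0 ≤ h' y) (h1' : ∀ y, h' y ≤ 1)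
    {f : ℝ → ℝ} (hf : ∀ y s, h y - Real.exp s * h' y ≤ f s) (s : ℝ) :
    ∫ y, h y ∂P - Real.exp s * ∫ y, h' y ∂Q ≤ mix a t f s := by
  have iP := integrable_of_unit_interval P hm h0 h1
  have iQ := integrable_of_unit_interval Q hm h0 h1
  have iP' := integrable_of_unit_interval P hm' h0' h1'
  have iQ' := integrable_of_unit_interval Q hm' h0' h1'
  have key : ∀ r c : ℝ, ∀ (ν : Measure Y) [IsProbabilityMeasure ν], Integrable h ν →
      Integrable h' ν → ∫ y, (c + (Real.exp r * h' y - h y)) ∂ν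
        = c + (Real.exp r * ∫ y, h' y ∂ν - ∫ y, h y ∂ν) := by
    intro r c ν _ i i'
    have j : Integrable (fun y => Real.exp r * h' y - h y) ν := (i'.const_mul _).sub i
    rw [integral_add (integrable_const _) j,
      integral_sub (i'.const_mul _) i, integral_const_mul]
    simp
  have A := integral_le_mul_integral (Real.exp_pos _).le hlow
    (h := fun y => f (s - t) + (Real.exp (s - t) * h' y - h y))
    (fun y => by linarith [hf y (s - t)])
    ((integrable_const _).add ((iP'.const_mul _).sub iP))
  have B := integral_le_mul_integral (Real.exp_pos _).le hup
    (h := fun y => f (s - t + a) + (Real.exp (s - t + a) * h' y - h y))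
    (fun y => by linarith [hf y (s - t + a)])
    ((integrable_const _).add ((iQ'.const_mul _).sub iQ))
  rw [key _ _ P iP iP', key _ _ Q iQ iQ'] at A B
  generalize (∫ y, h y ∂P) = p at *
  generalize (∫ y, h y ∂Q) = p₂ at *
  generalize (∫ y, h' y ∂P) = p₃ at *
  generalize (∫ y, h' y ∂Q) = p₄ at *
  have hk := one_sub_exp_neg_pos ha
  have e1 : Real.exp (s - t) = Real.exp s * Real.exp (-t) := by rw [← Real.exp_add]; ring_nf
  have e2 : Real.exp (s - t + a) = Real.exp s * Real.exp (-t) * Real.exp a := by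
    rw [← Real.exp_add, ← Real.exp_add]; ring_nf
  have e3 : Real.exp (a - t) = Real.exp a * Real.exp (-t) := by rw [← Real.exp_add]; ring_nf
  have e4 : Real.exp (t - a) = Real.exp t * Real.exp (-a) := by rw [← Real.exp_add]; ring_nf
  have u1 : Real.exp t * Real.exp (-t) = 1 := by rw [← Real.exp_add]; simp
  have u2 : Real.exp a * Real.exp (-a) = 1 := by rw [← Real.exp_add]; simp
  have hq := q_mul ha t
  rw [e4] at hq
  rw [e1, e3] at A
  rw [e2] at B
  have p1 := Real.exp_pos t
  have p2 := Real.exp_pos (-a)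
  rw [mix]
  generalize q a t = w at *
  generalize f (s - t) = f1 at *
  generalize f (s - t + a) = f2 at *
  generalize Real.exp s = es at *
  generalize Real.exp t = et at *
  generalize Real.exp (-t) = et' at *
  generalize Real.exp a = ea at *
  generalize Real.exp (-a) = ea' at *
  refine le_of_mul_le_mul_right ?_ hk
  -- The multipliers e^(t-a) and e^(-a) are chosen so that, on adding, the unwanted integrals of `h`
  -- against `Q` and of `h'` against `P` cancel.
  have A' := mul_le_mul_of_nonneg_left A (mul_pos p1 p2).le
  have B' := mul_le_mul_of_nonneg_left B p2.le
  have A'' : et * ea' * f1 + es * ea' * p₄ - et * ea' * p₂ ≤ f1 + es * et' * p₃ - p := by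
    linear_combination A' - es * ea' * p₄ * u1
      + (f1 + es * et' * p₃ - p) * (ea * ea' * u1 + u2)
  have B'' : ea' * f2 + es * et' * p₃ - ea' * p ≤ et * ea' * f2 + es * p₄ - et * ea' * p₂ := by
    linear_combination B' - es * et' * p₃ * u2 + es * p₄ * (ea * ea' * u1 + u2)
  linear_combination A'' + B'' - (f1 - f2) * hq

theorem integral_unit_interval {Y : Type} [MeasurableSpace Y] (P : Measure Y)
    [IsProbabilityMeasure P] {h : Y → ℝ} (h0 : ∀ y, 0 ≤ h y) (h1 : ∀ y, h y ≤ 1) :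
    0 ≤ ∫ y, h y ∂P ∧ ∫ y, h y ∂P ≤ 1 := by
  refine ⟨integral_nonneg h0, ?_⟩
  by_cases hi : Integrable h P
  · simpa using integral_mono hi (integrable_const (1 : ℝ)) h1
  · rw [integral_undef hi]; exact zero_le_one

theorem measurable_integral_kernel {Y Z : Type} [MeasurableSpace Y] [MeasurableSpace Z]
    (κ : Kernel Y Z) [IsMarkovKernel κ] {h : Y × Z → ℝ} (hm : Measurable h) :
    Measurable fun y => ∫ z, h (y, z) ∂(κ y) :=
  (hm.stronglyMeasurable.integral_kernel_prod_right').measurable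

theorem real_compProd_compProd {Y₁ Y₂ Y₃ : Type} [MeasurableSpace Y₁] [MeasurableSpace Y₂]
    [MeasurableSpace Y₃] (P : Measure Y₁) [IsProbabilityMeasure P] (κ : Kernel Y₁ Y₂)
    [IsMarkovKernel κ] (η : Kernel (Y₁ × Y₂) Y₃) [IsMarkovKernel η] {S : Set ((Y₁ × Y₂) × Y₃)}
    (hS : MeasurableSet S) :
    ((P ⊗ₘ κ) ⊗ₘ η).real S
      = ∫ y₁, ∫ y₂, ∫ y₃, S.indicator 1 ((y₁, y₂), y₃) ∂(η (y₁, y₂)) ∂(κ y₁) ∂P := by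
  have hm : Measurable (S.indicator (1 : (Y₁ × Y₂) × Y₃ → ℝ)) := measurable_one.indicator hS
  have hi : Integrable (S.indicator (1 : (Y₁ × Y₂) × Y₃ → ℝ)) ((P ⊗ₘ κ) ⊗ₘ η) :=
    (integrable_const (1 : ℝ)).indicator hS
  rw [← integral_indicator_one hS, Measure.integral_compProd hi,
    Measure.integral_compProd]
  have b (y) := integral_unit_interval (η y)
    (fun z => Set.indicator_nonneg (f := (1 : (Y₁ × Y₂) × Y₃ → ℝ)) (s := S) (by simp) (y, z))
    (fun z => Set.indicator_le_self' (by simp) (y, z))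
  exact integrable_of_unit_interval _ (measurable_integral_kernel η hm) (fun y => (b y).1)
    fun y => (b y).2

/-! ### Generalized randomized response attains the bound -/

/-- The response distributions of generalized randomized response. -/
noncomputable def coin (p : ℝ) : Measure Bool :=
  ENNReal.ofReal p • Measure.dirac true + ENNReal.ofReal (1 - p) • Measure.dirac false

/-- Generalized randomized response with privacy losses `t` and `t - a`, `p = (a, t)`. -/
noncomputable def response (p : ℝ × ℝ) (b : Bool) : Measure Bool :=
  coin (if b then q p.1 p.2 else Real.exp (-p.2) * q p.1 p.2)

theorem isProbabilityMeasure_coin {p : ℝ} (h0 : 0 ≤ p) (h1 : p ≤ 1) :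
    IsProbabilityMeasure (coin p) := by
  constructor
  simp only [coin, Measure.add_apply, Measure.smul_apply, measure_univ, smul_eq_mul, mul_one]
  rw [← ENNReal.ofReal_add h0 (by linarith)]
  simp

theorem integral_coin {p : ℝ} (h0 : 0 ≤ p) (h1 : p ≤ 1) (h : Bool → ℝ) :
    ∫ b, h b ∂(coin p) = p * h true + (1 - p) * h false := by
  have i (c : ℝ) (b : Bool) : Integrable h (ENNReal.ofReal c • Measure.dirac b) :=
    (integrable_dirac (by simp)).smul_measure ENNReal.ofReal_ne_top
  rw [coin, integral_add_measure (i _ _) (i _ _), integral_smul_measure, integral_smul_measure,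
    integral_dirac, integral_dirac, ENNReal.toReal_ofReal h0,
    ENNReal.toReal_ofReal (by linarith), smul_eq_mul, smul_eq_mul]

theorem real_coin {p : ℝ} (h0 : 0 ≤ p) (h1 : p ≤ 1) (S : Set Bool) :
    (coin p).real S = p * S.indicator 1 true + (1 - p) * S.indicator 1 false := by
  rw [← integral_coin h0 h1, integral_indicator_one (Set.Finite.measurableSet S.toFinite)]

theorem response_param_mem {p : ℝ × ℝ} (hp : p ∈ validParams) (b : Bool) :
    (if b then q p.1 p.2 else Real.exp (-p.2) * q p.1 p.2) ∈ Set.Icc (0 : ℝ) 1 := by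
  have h0 := q_nonneg hp.1 hp.2.2
  have h1 := q_le_one hp.1 hp.2.1
  have h2 := Real.exp_pos (-p.2)
  have h3 : Real.exp (-p.2) ≤ 1 := by rw [Real.exp_le_one_iff]; linarith [hp.2.1]
  cases b
  · exact ⟨by simpa using mul_nonneg h2.le h0, by simpa using mul_le_one₀ h3 h0 h1⟩
  · exact ⟨by simpa using h0, by simpa using h1⟩

theorem isProbabilityMeasure_response {p : ℝ × ℝ} (hp : p ∈ validParams) (b : Bool) :
    IsProbabilityMeasure (response p b) :=
  isProbabilityMeasure_coin (response_param_mem hp b).1 (response_param_mem hp b).2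

theorem response_true_le {p : ℝ × ℝ} (hp : p ∈ validParams) (S : Set Bool) :
    (response p true).real S ≤ Real.exp p.2 * (response p false).real S := by
  have ht := response_param_mem hp true
  have hf := response_param_mem hp false
  rw [response, response, real_coin ht.1 ht.2, real_coin hf.1 hf.2]
  have e : Real.exp p.2 * Real.exp (-p.2) = 1 := by rw [← Real.exp_add]; simp
  have h1 := q_le_one hp.1 hp.2.1
  have h3 : 1 ≤ Real.exp p.2 := Real.one_le_exp hp.2.1
  have hi : 0 ≤ S.indicator (1 : Bool → ℝ) false := Set.indicator_nonneg (by simp) _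
  simp only [if_true, Bool.false_eq_true, if_false]
  have := mul_nonneg (sub_nonneg.2 h3) hi
  linear_combination this - (q p.1 p.2 * S.indicator (1 : Bool → ℝ) true
    - q p.1 p.2 * S.indicator (1 : Bool → ℝ) false) * e

theorem response_false_le {p : ℝ × ℝ} (hp : p ∈ validParams) (S : Set Bool) :
    (response p false).real S ≤ Real.exp (p.1 - p.2) * (response p true).real S := by
  have ht := response_param_mem hp true
  have hf := response_param_mem hp false
  rw [response, response, real_coin ht.1 ht.2, real_coin hf.1 hf.2]
  have e := q_mul_exp_neg_add hp.1 p.2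
  have h0 := q_nonneg hp.1 hp.2.2
  have h3 : Real.exp (-p.2) ≤ Real.exp (p.1 - p.2) := by
    rw [Real.exp_le_exp]; linarith [hp.1]
  have hi : 0 ≤ S.indicator (1 : Bool → ℝ) true := Set.indicator_nonneg (by simp) _
  simp only [if_true, Bool.false_eq_true, if_false]
  have := mul_nonneg (mul_nonneg (sub_nonneg.2 h3) h0) hi
  linear_combination this - S.indicator (1 : Bool → ℝ) false * e

/-- The threshold left over after the response `b` at threshold `s`. -/
def nextLoss (p : ℝ × ℝ) (s : ℝ) (b : Bool) : ℝ := if b then s - p.2 else s - p.2 + p.1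

/-- Counterpart of `integral_sub_le_mix`: each outcome has an exact likelihood ratio, so factoring
it out of e^s turns the threshold `s` into `nextLoss p s b`. -/
theorem mix_le_integral_response {p : ℝ × ℝ} (hp : p ∈ validParams) {f : ℝ → ℝ} {s : ℝ}
    {h h' : Bool → ℝ}
    (hf : ∀ b, f (nextLoss p s b) ≤ h b - Real.exp (nextLoss p s b) * h' b) :
    mix p.1 p.2 f s
      ≤ ∫ b, h b ∂(response p true) - Real.exp s * ∫ b, h' b ∂(response p false) := by
  have ht := response_param_mem hp true
  have hf' := response_param_mem hp false
  rw [response, response, integral_coin ht.1 ht.2, integral_coin hf'.1 hf'.2]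
  have a1 := mul_le_mul_of_nonneg_left (hf true) (q_nonneg hp.1 hp.2.2)
  have a2 := mul_le_mul_of_nonneg_left (hf false) (sub_nonneg.2 (q_le_one hp.1 hp.2.1))
  have e := q_mul_exp_neg_add hp.1 p.2
  simp only [nextLoss, if_true, Bool.false_eq_true, if_false] at a1 a2 ⊢
  have e1 : Real.exp (s - p.2) = Real.exp s * Real.exp (-p.2) := by rw [← Real.exp_add]; ring_nf
  have e2 : Real.exp (s - p.2 + p.1) = Real.exp s * Real.exp (p.1 - p.2) := by
    rw [← Real.exp_add]; ring_nf
  rw [e1] at a1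
  rw [e2] at a2
  rw [mix]
  linear_combination a1 + a2 - Real.exp s * h' false * e

/-- `C` is the class of mechanisms whose neighbouring laws are dominated by generalized
randomized responses with parameters in `I`. -/
structure IsMixtureClass {X : Type u} (Adj : X → X → Prop) (C : MechClass X)
    (I : Set (ℝ × ℝ)) : Prop where
  nonempty : I.Nonempty
  valid : I ⊆ validParams
  prob : ∀ {Y : Type} [MeasurableSpace Y] {M : X → Measure Y}, C Y M →
    ∀ x, IsProbabilityMeasure (M x)
  bounds : ∀ {Y : Type} [MeasurableSpace Y] {M : X → Measure Y}, C Y M →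
    ∀ {x x'}, Adj x x' → ∃ p ∈ I,
      (∀ S, MeasurableSet S → (M x').real S ≤ Real.exp (p.1 - p.2) * (M x).real S) ∧
      ∀ S, MeasurableSet S → (M x).real S ≤ Real.exp p.2 * (M x').real S
  response_mem : ∀ p ∈ I, ∀ b : X → Bool, C Bool (fun x => response p (b x))

/-! ### Upper bound for adaptive compositions -/

section Upper

variable {X : Type u} {Adj : X → X → Prop}

theorem IsMixtureClass.integral_sub_le {C : MechClass X} {I : Set (ℝ × ℝ)}
    (hC : IsMixtureClass Adj C I) {Y : Type} [MeasurableSpace Y] {M : X → Measure Y} (hM : C Y M)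
    {x x' : X} (hx : Adj x x')
    {h h' : Y → ℝ} (hm : Measurable h) (hm' : Measurable h')
    (h0 : ∀ y, 0 ≤ h y) (h1 : ∀ y, h y ≤ 1) (h0' : ∀ y, 0 ≤ h' y) (h1' : ∀ y, h' y ≤ 1)
    {f : ℝ → ℝ} (hf1 : ∀ s, f s ≤ 1) (hf : ∀ y s, h y - Real.exp s * h' y ≤ f s) (s : ℝ) :
    ∫ y, h y ∂(M x) - Real.exp s * ∫ y, h' y ∂(M x') ≤ supMix I f s := by
  obtain ⟨p, hp, hl, hu⟩ := hC.bounds hM hx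
  have := hC.prob hM x
  have := hC.prob hM x'
  exact (integral_sub_le_mix (hC.valid hp).1 hl hu hm hm' h0 h1 h0' h1' hf s).trans
    (mix_le_supMix hC.valid hf1 hp s)

/-- The event probability is a triple integral, and the one-stage bound is applied from the outside
in. Each stage asks for a bound on the inner integrals at every threshold; innermost, both
integrands are the same indicator, which `trivialLoss` dominates. -/
theorem adaptive_isDP {C₁ C₂ C₃ : MechClass X} {I₁ I₂ I₃ : Set (ℝ × ℝ)}
    (h₁ : IsMixtureClass Adj C₁ I₁) (h₂ : IsMixtureClass Adj C₂ I₂)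
    (h₃ : IsMixtureClass Adj C₃ I₃) {Y : Type} [MeasurableSpace Y] {M : X → Measure Y}
    (hM : Adaptive C₁ C₂ C₃ Y M) (s : ℝ) :
    IsDP Adj M s (supMix I₁ (supMix I₂ (supMix I₃ trivialLoss)) s) := by
  obtain @⟨Y₁, Y₂, Y₃, _, _, _, M₁, M₂, M₃, m₁, m₂, m₃⟩ := hM
  intro x x' hx S hS
  have p₁ := h₁.prob m₁
  have p₂ (x) : IsMarkovKernel (M₂ x) := ⟨fun y => h₂.prob (m₂ y) x⟩
  have p₃ (x) : IsMarkovKernel (M₃ x) := ⟨fun y => h₃.prob (m₃ y) x⟩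
  rw [real_compProd_compProd _ _ _ hS, real_compProd_compProd _ _ _ hS, ← sub_le_iff_le_add']
  have mS : Measurable (S.indicator (1 : (Y₁ × Y₂) × Y₃ → ℝ)) := measurable_one.indicator hS
  have i0 (y) : 0 ≤ S.indicator (1 : (Y₁ × Y₂) × Y₃ → ℝ) y := Set.indicator_nonneg (by simp) y
  have i1 (y) : S.indicator (1 : (Y₁ × Y₂) × Y₃ → ℝ) y ≤ 1 := Set.indicator_le_self' (by simp) y
  have b3 (x y) := integral_unit_interval (M₃ x y) (fun z => i0 (y, z)) (fun z => i1 (y, z))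
  have n3 (x) := measurable_integral_kernel (M₃ x) mS
  have b2 (x y) := integral_unit_interval (M₂ x y) (fun z => (b3 x (y, z)).1)
    (fun z => (b3 x (y, z)).2)
  have n2 (x) := measurable_integral_kernel (M₂ x) (n3 x)
  have l3 := supMix_le_one h₃.valid trivialLoss_le_one
  have l2 := supMix_le_one h₂.valid l3
  refine h₁.integral_sub_le m₁ hx (n2 x) (n2 x') (fun y => (b2 x y).1) (fun y => (b2 x y).2)
    (fun y => (b2 x' y).1) (fun y => (b2 x' y).2) l2 (fun y₁ s => ?_) s
  refine h₂.integral_sub_le (m₂ y₁) hx ((n3 x).comp measurable_prodMk_left)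
    ((n3 x').comp measurable_prodMk_left) (fun y => (b3 x _).1) (fun y => (b3 x _).2)
    (fun y => (b3 x' _).1) (fun y => (b3 x' _).2) l3 (fun y₂ s => ?_) s
  refine h₃.integral_sub_le (m₃ (y₁, y₂)) hx (mS.comp measurable_prodMk_left)
    (mS.comp measurable_prodMk_left) (fun y => i0 _) (fun y => i1 _) (fun y => i0 _)
    (fun y => i1 _) trivialLoss_le_one (fun y₃ s => ?_) s
  by_cases hy : ((y₁, y₂), y₃) ∈ S
  · simp [hy, trivialLoss]
  · simp [hy, trivialLoss]

end Upper

/-! ### Lower bound by threshold-dependent responses -/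

section Lower

variable {X : Type u} {Adj : X → X → Prop}

theorem le_deltaOptMech {Y : Type} [MeasurableSpace Y] {M : X → Measure Y}
    (hM : ∀ x, IsProbabilityMeasure (M x)) {x x' : X} (hx : Adj x x') {S : Set Y}
    (hS : MeasurableSet S) (s : ℝ) :
    (M x).real S - Real.exp s * (M x').real S ≤ deltaOptMech Adj M s := by
  refine le_csInf ⟨1, zero_le_one, fun x x' _ S _ => ?_⟩ fun δ hδ => ?_
  · have h1 : (M x).real S ≤ 1 := measureReal_le_one
    have h2 : 0 ≤ Real.exp s * (M x').real S := by positivity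
    linarith
  · linarith [hδ.2 x x' hx S hS]

theorem deltaOptMech_le {Y : Type} [MeasurableSpace Y] {M : X → Measure Y} {s δ : ℝ}
    (h0 : 0 ≤ δ) (h : IsDP Adj M s δ) : deltaOptMech Adj M s ≤ δ :=
  csInf_le ⟨0, fun _ h => h.1⟩ ⟨h0, h⟩

/-- The remaining threshold after earlier responses is a function of those responses, so an adaptive
mechanism may let it select the next coin through `π₂` and `π₃`. -/
theorem exists_adaptive {C₁ C₂ C₃ : MechClass X} {I₁ I₂ I₃ : Set (ℝ × ℝ)}
    (h₁ : IsMixtureClass Adj C₁ I₁) (h₂ : IsMixtureClass Adj C₂ I₂)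
    (h₃ : IsMixtureClass Adj C₃ I₃) (hne : ∃ x x', x ≠ x' ∧ Adj x x') {p : ℝ × ℝ} (hp : p ∈ I₁)
    {π₂ π₃ : ℝ → ℝ × ℝ} (hπ₂ : ∀ s, π₂ s ∈ I₂) (hπ₃ : ∀ s, π₃ s ∈ I₃) {f₂ f₃ : ℝ → ℝ}
    (hf₃ : ∀ s, f₃ s ≤ mix (π₃ s).1 (π₃ s).2 trivialLoss s)
    (hf₂ : ∀ s, f₂ s ≤ mix (π₂ s).1 (π₂ s).2 f₃ s) (s : ℝ) :
    ∃ (Y : Type) (_ : MeasurableSpace Y) (M : X → Measure Y), Adaptive C₁ C₂ C₃ Y M ∧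
      mix p.1 p.2 f₂ s ≤ deltaOptMech Adj M s := by
  classical
  obtain ⟨x₀, x₁, hx, hadj⟩ := hne
  -- Only the label of the dataset is used; `x₀ ≠ x₁` makes the two neighbours receive opposite
  -- labels.
  let side : X → Bool := fun x => decide (x = x₀)
  let M₁ : X → Measure Bool := fun x => response p (side x)
  let M₂ : X → Kernel Bool Bool := fun x => Kernel.ofFunOfCountable fun b =>
    response (π₂ (nextLoss p s b)) (side x)
  let r : Bool × Bool → ℝ := fun b => nextLoss (π₂ (nextLoss p s b.1)) (nextLoss p s b.1) b.2
  let M₃ : X → Kernel (Bool × Bool) Bool := fun x => Kernel.ofFunOfCountable fun b =>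
    response (π₃ (r b)) (side x)
  have p₁ (x) : IsProbabilityMeasure (M₁ x) := isProbabilityMeasure_response (h₁.valid hp) _
  have p₂ (x) : IsMarkovKernel (M₂ x) :=
    ⟨fun b => isProbabilityMeasure_response (h₂.valid (hπ₂ _)) _⟩
  have p₃ (x) : IsMarkovKernel (M₃ x) :=
    ⟨fun b => isProbabilityMeasure_response (h₃.valid (hπ₃ _)) _⟩
  refine ⟨_, _, _, Adaptive.mk M₁ M₂ M₃ (h₁.response_mem p hp side)
    (fun b => h₂.response_mem _ (hπ₂ _) side) (fun b => h₃.response_mem _ (hπ₃ _) side), ?_⟩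
  -- The optimal event: a negative final threshold r means 1 - e^r > 0, so including the outcome
  -- increases the difference.
  let S : Set ((Bool × Bool) × Bool) := {b | nextLoss (π₃ (r b.1)) (r b.1) b.2 < 0}
  have hS : MeasurableSet S := S.to_countable.measurableSet
  refine le_trans ?_ (le_deltaOptMech (fun x => inferInstance) hadj hS s)
  rw [real_compProd_compProd _ _ _ hS, real_compProd_compProd _ _ _ hS]
  have e1 : side x₀ = true := by simp [side]
  have e2 : side x₁ = false := by simpa [side] using hx.symm
  have a2 (x c) : M₂ x c = response (π₂ (nextLoss p s c)) (side x) := rfl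
  have a3 (x c) : M₃ x c = response (π₃ (r c)) (side x) := rfl
  simp only [M₁, a2, a3, e1, e2]
  refine mix_le_integral_response (h₁.valid hp) fun b₁ => (hf₂ _).trans ?_
  refine mix_le_integral_response (h₂.valid (hπ₂ _)) fun b₂ => (hf₃ _).trans ?_
  refine mix_le_integral_response (h₃.valid (hπ₃ _)) fun b₃ => ?_
  change trivialLoss (nextLoss (π₃ (r (b₁, b₂))) (r (b₁, b₂)) b₃) ≤ _ -
    Real.exp (nextLoss (π₃ (r (b₁, b₂))) (r (b₁, b₂)) b₃) * _
  by_cases hb : nextLoss (π₃ (r (b₁, b₂))) (r (b₁, b₂)) b₃ < 0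
  · have hm : ((b₁, b₂), b₃) ∈ S := hb
    rw [Set.indicator_of_mem hm, trivialLoss, max_eq_right]
    · simp
    · linarith [Real.exp_lt_one_iff.2 hb]
  · have hm : ((b₁, b₂), b₃) ∉ S := hb
    rw [Set.indicator_of_notMem hm, trivialLoss, max_eq_left]
    · simp
    · linarith [Real.one_le_exp (not_lt.1 hb)]

theorem exists_mix_ge {I : Set (ℝ × ℝ)} (hI : I.Nonempty) {f : ℝ → ℝ} {η : ℝ}
    (hη : 0 < η) (s : ℝ) : ∃ p ∈ I, supMix I f s - η ≤ mix p.1 p.2 f s := by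
  obtain ⟨_, ⟨p, hp, rfl⟩, h⟩ := exists_lt_of_lt_csSup
    (hI.image (fun p : ℝ × ℝ => mix p.1 p.2 f s)) (sub_lt_self (supMix I f s) hη)
  exact ⟨p, hp, h.le⟩

/-- The optimal `δ` of adaptive compositions as an iterated supremum. -/
theorem deltaOpt_adaptive {C₁ C₂ C₃ : MechClass X} {I₁ I₂ I₃ : Set (ℝ × ℝ)}
    (h₁ : IsMixtureClass Adj C₁ I₁) (h₂ : IsMixtureClass Adj C₂ I₂)
    (h₃ : IsMixtureClass Adj C₃ I₃) (hne : ∃ x x', x ≠ x' ∧ Adj x x') (s : ℝ) :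
    deltaOpt Adj (Adaptive C₁ C₂ C₃) s
      = supMix I₁ (supMix I₂ (supMix I₃ trivialLoss)) s := by
  have n : 0 ≤ supMix I₁ (supMix I₂ (supMix I₃ trivialLoss)) s :=
    supMix_nonneg h₁.valid (supMix_nonneg h₂.valid (supMix_nonneg h₃.valid trivialLoss_nonneg)) s
  have ub : ∀ d ∈ {d : ℝ | ∃ (Y : Type) (_ : MeasurableSpace Y) (M : X → Measure Y),
      Adaptive C₁ C₂ C₃ Y M ∧ d = deltaOptMech Adj M s},
      d ≤ supMix I₁ (supMix I₂ (supMix I₃ trivialLoss)) s := by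
    rintro d ⟨Y, _, M, hM, rfl⟩
    exact deltaOptMech_le n (adaptive_isDP h₁ h₂ h₃ hM s)
  refine le_antisymm (Real.sSup_le ub n) (le_of_forall_pos_le_add fun η hη => ?_)
  have hη' : 0 < η / 3 := by positivity
  choose π₃ hπ₃ g₃ using exists_mix_ge h₃.nonempty (f := trivialLoss) hη'
  choose π₂ hπ₂ g₂ using exists_mix_ge h₂.nonempty (f := supMix I₃ trivialLoss) hη'
  obtain ⟨p, hp, g₁⟩ := exists_mix_ge h₁.nonempty (f := supMix I₂ (supMix I₃ trivialLoss)) hη' s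
  -- Near-maximizers lose η/3 at each of three stages; averaging passes a constant loss on
  -- unchanged, so the total is η.
  obtain ⟨Y, _, M, hM, hle⟩ := exists_adaptive h₁ h₂ h₃ hne hp hπ₂ hπ₃
    (f₂ := fun r => supMix I₂ (supMix I₃ trivialLoss) r - η / 3 - η / 3) g₃
    (fun r => by rw [mix_sub_const]; linarith [g₂ r]) s
  rw [mix_sub_const, mix_sub_const] at hle
  have := le_csSup ⟨_, ub⟩ ⟨Y, _, M, hM, rfl⟩
  rw [deltaOpt]
  linarith

end Lower

/-! ### DP and BR as mixture classes -/

section Classes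

variable {X : Type u} {Adj : X → X → Prop}

/-- The parameters of `ε`-DP mechanisms. -/
def dpParams (ε : ℝ) : Set (ℝ × ℝ) := {(2 * ε, ε)}

/-- The parameters of `ε`-BR mechanisms. -/
def brParams (ε : ℝ) : Set (ℝ × ℝ) := (fun t => (ε, t)) '' Set.Icc 0 ε

theorem dpParams_subset {ε : ℝ} (hε : 0 < ε) : dpParams ε ⊆ validParams := by
  rintro _ rfl
  exact ⟨by simpa using hε, hε.le, by simp only; linarith⟩

theorem brParams_subset {ε : ℝ} (hε : 0 < ε) : brParams ε ⊆ validParams := by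
  rintro _ ⟨t, ht, rfl⟩
  exact ⟨hε, ht.1, ht.2⟩

/-- Symmetry of the relation supplies the reverse domination bound; with (a, t) = (2ε, ε) both t and
a - t equal ε. -/
theorem isMixtureClass_DP (hsymm : ∀ x x', Adj x x' → Adj x' x) {ε : ℝ} (hε : 0 < ε) :
    IsMixtureClass Adj (DP Adj ε) (dpParams ε) where
  nonempty := Set.singleton_nonempty _
  valid := dpParams_subset hε
  prob h := h.1
  bounds h _ _ hx := by
    refine ⟨_, rfl, fun S hS => ?_, fun S hS => ?_⟩
    · have := h.2 _ _ (hsymm _ _ hx) S hS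
      rw [add_zero] at this
      convert this using 3
      ring
    · simpa using h.2 _ _ hx S hS
  response_mem := by
    rintro p rfl b
    have hv := dpParams_subset hε rfl
    refine ⟨fun x => isProbabilityMeasure_response hv _, fun x x' _ S hS => ?_⟩
    have h1 := response_true_le hv S
    have h2 := response_false_le hv S
    have he : 1 ≤ Real.exp ε := Real.one_le_exp hε.le
    have e : 2 * ε - ε = ε := by ring
    simp only [e] at h2
    rw [add_zero]
    dsimp only
    cases b x <;> cases b x'
    · exact le_mul_of_one_le_left measureReal_nonneg he
    · exact h2
    · exact h1
    · exact le_mul_of_one_le_left measureReal_nonneg he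

theorem exists_bounds_of_boundedRange {Y : Type} [MeasurableSpace Y] {P Q : Measure Y}
    [IsProbabilityMeasure P] [IsProbabilityMeasure Q] {ε : ℝ}
    (h : ∀ S₁ S₂ : Set Y, MeasurableSet S₁ → MeasurableSet S₂ →
      P.real S₁ * Q.real S₂ ≤ Real.exp ε * (P.real S₂ * Q.real S₁)) :
    ∃ t ∈ Set.Icc 0 ε, (∀ S, MeasurableSet S → Q.real S ≤ Real.exp (ε - t) * P.real S) ∧
      ∀ S, MeasurableSet S → P.real S ≤ Real.exp t * Q.real S := by
  have hPQ (S : Set Y) (hS : MeasurableSet S) : P.real S ≤ Real.exp ε * Q.real S := by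
    simpa using h S _ hS MeasurableSet.univ
  -- The parameter is t = log sup (P S / Q S). The whole space gives ratio 1, hence t ≥ 0, and
  -- bounded range says that all ratios are within a factor e^ε of the supremum, which is the
  -- reverse bound.
  let R : Set ℝ := {r | ∃ S, MeasurableSet S ∧ 0 < Q.real S ∧ r = P.real S / Q.real S}
  have hR (r) (hr : r ∈ R) : r ≤ Real.exp ε := by
    obtain ⟨S, hS, hQ, rfl⟩ := hr
    rw [div_le_iff₀ hQ]
    exact hPQ S hS
  have h1 : (1 : ℝ) ∈ R := ⟨Set.univ, MeasurableSet.univ, by simp, by simp⟩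
  have hm1 : 1 ≤ sSup R := le_csSup ⟨_, hR⟩ h1
  have hm0 : 0 < sSup R := by linarith
  have hme : sSup R ≤ Real.exp ε := csSup_le ⟨1, h1⟩ hR
  refine ⟨Real.log (sSup R), ⟨Real.log_nonneg hm1, ?_⟩, fun S hS => ?_, fun S hS => ?_⟩
  · rwa [Real.log_le_iff_le_exp hm0]
  · rw [Real.exp_sub, Real.exp_log hm0, div_mul_eq_mul_div, le_div_iff₀ hm0]
    rcases (measureReal_nonneg (μ := Q) (s := S)).eq_or_lt with hQ | hQ
    · rw [← hQ, zero_mul]; positivity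
    · rw [← le_div_iff₀' hQ]
      refine csSup_le ⟨1, h1⟩ ?_
      rintro _ ⟨S₁, hS₁, hQ₁, rfl⟩
      rw [div_le_div_iff₀ hQ₁ hQ, mul_assoc]
      exact h S₁ S hS₁ hS
  · rw [Real.exp_log hm0]
    rcases (measureReal_nonneg (μ := Q) (s := S)).eq_or_lt with hQ | hQ
    · have := hPQ S hS
      rw [← hQ] at this ⊢
      simpa using this
    · rw [← div_le_iff₀ hQ]
      exact le_csSup ⟨_, hR⟩ ⟨S, hS, hQ, rfl⟩

theorem isMixtureClass_BR {ε : ℝ} (hε : 0 < ε) :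
    IsMixtureClass Adj (BR Adj ε) (brParams ε) where
  nonempty := (Set.nonempty_Icc.2 hε.le).image _
  valid := brParams_subset hε
  prob h := h.1
  bounds h x x' hx := by
    have := h.1 x
    have := h.1 x'
    obtain ⟨t, ht, h1, h2⟩ := exists_bounds_of_boundedRange (h.2 x x' hx)
    exact ⟨_, ⟨t, ht, rfl⟩, h1, h2⟩
  response_mem := by
    rintro p hp b
    have hv := brParams_subset hε hp
    obtain ⟨t, ht, rfl⟩ := hp
    refine ⟨fun x => isProbabilityMeasure_response hv _, fun x x' _ S₁ S₂ hS₁ hS₂ => ?_⟩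
    have h1 := response_true_le hv
    have h2 := response_false_le hv
    have he : 1 ≤ Real.exp ε := Real.one_le_exp hε.le
    have e : Real.exp t * Real.exp (ε - t) = Real.exp ε := by rw [← Real.exp_add]; ring_nf
    simp only at h1 h2
    dsimp only
    -- For opposite labels the factors e^t and e^(ε-t) multiply to e^ε, in either orientation; for
    -- equal labels only 1 ≤ e^ε is needed.
    cases b x <;> cases b x'
    · rw [mul_comm ((response (ε, t) false).real S₂)]
      exact le_mul_of_one_le_left (by positivity) he
    · calc _ ≤ _ := mul_le_mul (h2 S₁) (h1 S₂) (by positivity) (by positivity)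
        _ = _ := by rw [← e]; ring
    · calc _ ≤ _ := mul_le_mul (h1 S₁) (h2 S₂) (by positivity) (by positivity)
        _ = _ := by rw [← e]; ring
    · rw [mul_comm ((response (ε, t) true).real S₂)]
      exact le_mul_of_one_le_left (by positivity) he

end Classes

/-! ### Commutation and the explicit BR profile -/

theorem supMix_dpParams (ε : ℝ) (f : ℝ → ℝ) : supMix (dpParams ε) f = mix (2 * ε) ε f := by
  funext s
  simp [supMix, dpParams]

theorem supMix_brParams (ε : ℝ) (f : ℝ → ℝ) (s : ℝ) :
    supMix (brParams ε) f s = sSup ((fun t => mix ε t f s) '' Set.Icc 0 ε) := by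
  rw [supMix, brParams, Set.image_image]

theorem mix_comm (a b t r : ℝ) (f : ℝ → ℝ) (s : ℝ) :
    mix a t (mix b r f) s = mix b r (mix a t f) s := by
  have e1 : s - t + a - r = s - r - t + a := by ring
  have e2 : s - t - r = s - r - t := by ring
  have e4 : s - r - t + a + b = s - r + b - t + a := by ring
  simp only [mix, e1, e2, e4]
  have e5 : s - r - t + b = s - r + b - t := by ring
  rw [e5]
  ring

/-- The function 1 - e^s is the value of the full event, whose probability is 1 under both laws
whatever the response. -/
theorem mix_one_sub_exp {a : ℝ} (ha : 0 < a) (t s : ℝ) :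
    mix a t (fun r => 1 - Real.exp r) s = 1 - Real.exp s := by
  have e := q_mul_exp_neg_add ha t
  have e1 : Real.exp (s - t) = Real.exp s * Real.exp (-t) := by rw [← Real.exp_add]; ring_nf
  have e2 : Real.exp (s - t + a) = Real.exp s * Real.exp (a - t) := by
    rw [← Real.exp_add]; ring_nf
  rw [mix, e1, e2]
  linear_combination -Real.exp s * e

theorem trivialLoss_of_nonneg {s : ℝ} (hs : 0 ≤ s) : trivialLoss s = 0 :=
  max_eq_left (by linarith [Real.one_le_exp hs])

theorem trivialLoss_of_nonpos {s : ℝ} (hs : s ≤ 0) : trivialLoss s = 1 - Real.exp s :=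
  max_eq_right (by linarith [Real.exp_le_one_iff.2 hs])

theorem mix_eq_zero {a t c s : ℝ} {f : ℝ → ℝ} (ha : 0 ≤ a) (hf : ∀ r, c ≤ r → f r = 0)
    (hs : c + t ≤ s) : mix a t f s = 0 := by
  rw [mix, hf _ (by linarith), hf _ (by linarith)]
  ring

theorem mix_trivialLoss_of_le {ε t s : ℝ} (hε : 0 < ε) (hs : s ≤ t - ε) :
    mix ε t trivialLoss s = 1 - Real.exp s := by
  rw [← mix_one_sub_exp hε t s, mix, mix, trivialLoss_of_nonpos (by linarith),
    trivialLoss_of_nonpos (by linarith)]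

theorem supMix_brParams_eq_of_forall {ε : ℝ} (hε : 0 < ε) {f : ℝ → ℝ} {s c : ℝ}
    (h : ∀ t ∈ Set.Icc 0 ε, mix ε t f s = c) : supMix (brParams ε) f s = c := by
  rw [supMix_brParams, Set.image_congr h, (Set.nonempty_Icc.2 hε.le).image_const, csSup_singleton]

theorem brLoss_of_ge {ε s : ℝ} (hε : 0 < ε) (hs : ε ≤ s) :
    supMix (brParams ε) trivialLoss s = 0 :=
  supMix_brParams_eq_of_forall hε fun t ht =>
    mix_eq_zero hε.le (fun _ => trivialLoss_of_nonneg) (by linarith [ht.2])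

theorem brLoss_of_le {ε s : ℝ} (hε : 0 < ε) (hs : s ≤ -ε) :
    supMix (brParams ε) trivialLoss s = 1 - Real.exp s :=
  supMix_brParams_eq_of_forall hε fun t ht =>
    mix_trivialLoss_of_le hε (by linarith [ht.1])

theorem q_sq_mul {ε : ℝ} (hε : 0 < ε) (s : ℝ) :
    q ε ((s + ε) / 2) ^ 2 * (1 - Real.exp (-ε)) * (1 - Real.exp (-ε))
      = (1 - Real.exp (s / 2) * Real.exp (-ε / 2)) ^ 2 := by
  have h := q_mul hε ((s + ε) / 2)
  have e : (s + ε) / 2 - ε = s / 2 + -ε / 2 := by ring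
  rw [e, Real.exp_add] at h
  rw [← h]
  ring

/-- After clearing the denominator, the gap is a perfect square of half-exponentials when at least
one threshold is nonpositive; otherwise the left side vanishes. -/
theorem mix_trivialLoss_le {ε t s : ℝ} (hε : 0 < ε) :
    mix ε t trivialLoss s ≤ q ε ((s + ε) / 2) ^ 2 * (1 - Real.exp (-ε)) := by
  have hk := one_sub_exp_neg_pos hε
  rcases le_total 0 (s - t) with h1 | h1
  · rw [mix, trivialLoss_of_nonneg h1, trivialLoss_of_nonneg (by linarith)]
    simp only [mul_zero, add_zero]
    positivity
  refine le_of_mul_le_mul_right ?_ hk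
  rw [q_sq_mul hε]
  have sq (r : ℝ) : Real.exp r = Real.exp (r / 2) ^ 2 := by
    rw [← Real.exp_nat_mul]; congr 1; push_cast; ring
  rcases le_total 0 (s - t + ε) with h2 | h2
  · rw [mix, trivialLoss_of_nonpos h1, trivialLoss_of_nonneg h2, mul_zero, add_zero,
      mul_right_comm, q_mul hε, sq (t - ε), sq (s - t)]
    have e : Real.exp (s / 2) * Real.exp (-ε / 2)
        = Real.exp ((t - ε) / 2) * Real.exp ((s - t) / 2) := by
      rw [← Real.exp_add, ← Real.exp_add]; ring_nf
    rw [e]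
    linear_combination sq_nonneg (Real.exp ((t - ε) / 2) - Real.exp ((s - t) / 2))
  · rw [mix_trivialLoss_of_le hε (by linarith), sq s, sq (-ε)]
    linear_combination sq_nonneg (Real.exp (s / 2) - Real.exp (-ε / 2))

theorem brLoss_of_mem {ε s : ℝ} (hε : 0 < ε) (h1 : -ε ≤ s) (h2 : s ≤ ε) :
    supMix (brParams ε) trivialLoss s = q ε ((s + ε) / 2) ^ 2 * (1 - Real.exp (-ε)) := by
  apply le_antisymm
  · rw [supMix_brParams]
    refine csSup_le ((Set.nonempty_Icc.2 hε.le).image _) ?_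
    rintro _ ⟨t, ht, rfl⟩
    exact mix_trivialLoss_le hε
  -- This t makes s - t = t - ε, the equality case of the square; it lies in [0, ε] exactly when s
  -- lies in [-ε, ε].
  · have hp : (ε, (s + ε) / 2) ∈ brParams ε :=
      ⟨_, ⟨by linarith, by linarith⟩, rfl⟩
    refine le_trans ?_ (mix_le_supMix (brParams_subset hε) trivialLoss_le_one hp s)
    have hv := brParams_subset hε hp
    have e : s - (s + ε) / 2 = (s + ε) / 2 - ε := by ring
    have h0 := mul_nonneg (sub_nonneg.2 (q_le_one hv.1 hv.2.1))
      (trivialLoss_nonneg (s - (s + ε) / 2 + ε))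
    simp only [mix] at h0 ⊢
    have h3 : trivialLoss (s - (s + ε) / 2) = q ε ((s + ε) / 2) * (1 - Real.exp (-ε)) := by
      rw [q_mul hε, e, trivialLoss_of_nonpos (by linarith)]
    rw [h3]
    linear_combination h0

theorem sSup_image_mul_add {α : Type*} {A : Set α} (hA : A.Nonempty) {F : α → ℝ}
    (hF : BddAbove (F '' A)) {c : ℝ} (hc : 0 ≤ c) (d : ℝ) :
    sSup ((fun t => c * F t + d) '' A) = c * sSup (F '' A) + d := by
  have h := Monotone.map_csSup_of_continuousAt (f := fun x => c * x + d) (by fun_prop)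
    (fun x y h => by simpa using mul_le_mul_of_nonneg_left h hc) (hA.image F) hF
  rw [h, Set.image_image]

theorem bddAbove_mix_Icc {ε : ℝ} (hε : 0 < ε) {f : ℝ → ℝ} (hf : ∀ s, f s ≤ 1) (s : ℝ) :
    BddAbove ((fun t => mix ε t f s) '' Set.Icc 0 ε) := by
  simpa only [brParams, Set.image_image] using bddAbove_mix (brParams_subset hε) hf s

theorem dpWeight_mem {ε : ℝ} (hε : 0 < ε) : q (2 * ε) ε ∈ Set.Icc (0 : ℝ) 1 :=
  ⟨q_nonneg (by linarith) (by linarith), q_le_one (by linarith) hε.le⟩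

/-- Randomized response commutes with the BR supremum at the last stage. -/
theorem supMix_br_dp {ε : ℝ} (hε : 0 < ε) :
    supMix (brParams ε) (supMix (dpParams ε) trivialLoss)
      = supMix (dpParams ε) (supMix (brParams ε) trivialLoss) := by
  funext s
  have hw := dpWeight_mem hε
  have hA : (Set.Icc 0 ε).Nonempty := Set.nonempty_Icc.2 hε.le
  simp only [supMix_dpParams]
  rw [supMix_brParams]
  simp only [mix_comm ε (2 * ε)]
  -- For s ≥ 0 the term at s + ε vanishes for all t; for s ≤ 0 the term at s - ε equals 1 - e^(s-ε)
  -- for all t. Either way the supremum acts on a single term.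
  rcases le_total 0 s with hs | hs
  · rw [mix, brLoss_of_ge (s := s - ε + 2 * ε) hε (by linarith), mul_zero, supMix_brParams,
      ← sSup_image_mul_add hA (bddAbove_mix_Icc hε trivialLoss_le_one _) hw.1]
    congr 1
    refine Set.image_congr fun t ht => ?_
    rw [mix, mix_eq_zero (c := 0) (s := s - ε + 2 * ε) hε.le (fun _ => trivialLoss_of_nonneg)
      (by linarith [ht.2]), mul_zero]
  · rw [mix, brLoss_of_le (s := s - ε) hε (by linarith), supMix_brParams, add_comm,
      ← sSup_image_mul_add hA (bddAbove_mix_Icc hε trivialLoss_le_one _) (sub_nonneg.2 hw.2)]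
    congr 1
    refine Set.image_congr fun t ht => ?_
    rw [mix, mix_trivialLoss_of_le (s := s - ε) hε (by linarith [ht.1]), add_comm]

theorem brLoss_le_one {ε : ℝ} (hε : 0 < ε) (s : ℝ) : supMix (brParams ε) trivialLoss s ≤ 1 :=
  supMix_le_one (brParams_subset hε) trivialLoss_le_one s

theorem brLoss_nonneg {ε : ℝ} (hε : 0 < ε) (s : ℝ) : 0 ≤ supMix (brParams ε) trivialLoss s :=
  supMix_nonneg (brParams_subset hε) trivialLoss_nonneg s

/-- For large thresholds randomized response commutes with the BR supremum at the first stage. -/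
theorem supMix_br_dp_br_of_le {ε s : ℝ} (hε : 0 < ε) (hs : ε ≤ s) :
    supMix (brParams ε) (supMix (dpParams ε) (supMix (brParams ε) trivialLoss)) s
      = supMix (dpParams ε) (supMix (brParams ε) (supMix (brParams ε) trivialLoss)) s := by
  have hA : (Set.Icc 0 ε).Nonempty := Set.nonempty_Icc.2 hε.le
  -- Since s + ε ≥ 2ε, lowering the threshold by t ≤ ε leaves it at least ε, where the BR profile is
  -- zero.
  have hz (t) (ht : t ∈ Set.Icc 0 ε) :
      mix ε t (supMix (brParams ε) trivialLoss) (s - ε + 2 * ε) = 0 :=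
    mix_eq_zero hε.le (fun _ => brLoss_of_ge hε) (by linarith [ht.2])
  simp only [supMix_dpParams]
  rw [supMix_brParams, mix, supMix_brParams_eq_of_forall hε hz, mul_zero, supMix_brParams ε _ (s - ε),
    ← sSup_image_mul_add hA (bddAbove_mix_Icc hε (brLoss_le_one hε) _) (dpWeight_mem hε).1]
  congr 1
  refine Set.image_congr fun t ht => ?_
  rw [mix_comm, mix, hz t ht, mul_zero]

/-! ### Closed forms for small thresholds -/

theorem xFun_eq {ε εg t : ℝ} (hε : 0 < ε) (hg : εg ≤ ε) (ht : t ∈ Set.Ico 0 εg) :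
    q (2 * ε) ε * mix ε t (supMix (brParams ε) trivialLoss) (εg - ε) = xFun ε εg t := by
  obtain ⟨h1, h2⟩ := ht
  rw [mix, brLoss_of_mem hε (by linarith) (by linarith),
    brLoss_of_mem hε (by linarith) (by linarith), xFun]
  ring_nf

/-- Once t ≥ εg, the lower threshold εg - ε - t is at most -ε, so the BR profile is 1 - e^s there;
this is what separates y from x. -/
theorem yFun_eq {ε εg t : ℝ} (hε : 0 < ε) (hεg : 0 ≤ εg) (ht : t ∈ Set.Icc εg ε) :
    q (2 * ε) ε * mix ε t (supMix (brParams ε) trivialLoss) (εg - ε) = yFun ε εg t := by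
  obtain ⟨h1, h2⟩ := ht
  rw [mix, brLoss_of_le hε (by linarith), brLoss_of_mem hε (by linarith) (by linarith), yFun]
  ring_nf

theorem zFun_eq {ε εg t : ℝ} (hε : 0 < ε) (hεg : 0 ≤ εg) (ht : t ∈ Set.Icc εg ε) :
    (1 - q (2 * ε) ε) * mix ε t (supMix (brParams ε) trivialLoss) (εg - ε + 2 * ε)
      = zFun ε εg t := by
  obtain ⟨h1, h2⟩ := ht
  rw [mix, brLoss_of_mem hε (by linarith) (by linarith), brLoss_of_ge hε (by linarith), zFun]
  ring_nf

theorem mix_brLoss_eq_zero {ε εg t : ℝ} (hε : 0 < ε) (ht : t ∈ Set.Ico 0 εg) :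
    mix ε t (supMix (brParams ε) trivialLoss) (εg - ε + 2 * ε) = 0 :=
  mix_eq_zero hε.le (fun _ => brLoss_of_ge hε) (by linarith [ht.2])

theorem sSup_image_Icc_split {e ε : ℝ} (he : 0 ≤ e) (heε : e ≤ ε) {F G H : ℝ → ℝ}
    (hF : BddAbove (F '' Set.Icc 0 ε)) (hF0 : ∀ t ∈ Set.Icc 0 ε, 0 ≤ F t)
    (hG : ∀ t ∈ Set.Ico 0 e, F t = G t) (hH : ∀ t ∈ Set.Icc e ε, F t = H t) :
    sSup (F '' Set.Icc 0 ε) = max (sSup (G '' Set.Ico 0 e)) (sSup (H '' Set.Icc e ε)) := by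
  rw [← Set.image_congr hG, ← Set.image_congr hH]
  have hU : Set.Icc 0 ε = Set.Ico 0 e ∪ Set.Icc e ε := (Set.Ico_union_Icc_eq_Icc he heε).symm
  -- At e = 0 the first supremum is over the empty set and equals 0 by convention; nonnegativity of
  -- `F` makes it harmless in the maximum.
  rcases he.eq_or_lt with rfl | he'
  · rw [Set.Ico_self, Set.image_empty, Real.sSup_empty, max_eq_right]
    apply Real.sSup_nonneg
    rintro _ ⟨t, ht, rfl⟩
    exact hF0 t ht
  · rw [hU, Set.image_union] at hF ⊢
    exact csSup_union (hF.mono Set.subset_union_left) ((Set.nonempty_Ico.2 he').image _)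
      (hF.mono Set.subset_union_right) ((Set.nonempty_Icc.2 heε).image _)

theorem mix_brLoss_nonneg {ε t : ℝ} (hε : 0 < ε) (ht : t ∈ Set.Icc 0 ε) (s : ℝ) :
    0 ≤ mix ε t (supMix (brParams ε) trivialLoss) s :=
  mix_nonneg ⟨hε, ht⟩ (brLoss_nonneg hε) s

theorem mul_supMix_brParams {ε c s : ℝ} (hε : 0 < ε) (hc : 0 ≤ c) :
    c * supMix (brParams ε) (supMix (brParams ε) trivialLoss) s
      = sSup ((fun t => c * mix ε t (supMix (brParams ε) trivialLoss) s) '' Set.Icc 0 ε) := by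
  have := sSup_image_mul_add (Set.nonempty_Icc.2 hε.le)
    (bddAbove_mix_Icc hε (brLoss_le_one hε) s) hc 0
  simp only [add_zero] at this
  rw [this, supMix_brParams]

theorem supMix_dp_br_br {ε εg : ℝ} (hε : 0 < ε) (hεg : 0 ≤ εg) (hg : εg ≤ ε) :
    supMix (dpParams ε) (supMix (brParams ε) (supMix (brParams ε) trivialLoss)) εg
      = max (sSup (xFun ε εg '' Set.Ico 0 εg)) (sSup (yFun ε εg '' Set.Icc εg ε))
        + sSup (zFun ε εg '' Set.Icc εg ε) := by
  have hw := dpWeight_mem hε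
  have bdd {c : ℝ} (hc : 0 ≤ c) (s : ℝ) : BddAbove
      ((fun t => c * mix ε t (supMix (brParams ε) trivialLoss) s) '' Set.Icc 0 ε) := by
    refine ⟨c, ?_⟩
    rintro _ ⟨t, ht, rfl⟩
    exact mul_le_of_le_one_right hc (mix_le_one ⟨hε, ht⟩ (brLoss_le_one hε) s)
  rw [supMix_dpParams, mix, mul_supMix_brParams hε hw.1,
    mul_supMix_brParams hε (sub_nonneg.2 hw.2)]
  -- The two DP outcomes are maximized independently: one supremum yields x and y, the other z.
  congr 1
  · exact sSup_image_Icc_split hεg hg (bdd hw.1 _)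
      (fun t ht => mul_nonneg hw.1 (mix_brLoss_nonneg hε ht _))
      (fun t ht => xFun_eq hε hg ht) fun t ht => yFun_eq hε hεg ht
  · rw [sSup_image_Icc_split (G := fun _ => 0) (H := zFun ε εg) hεg hg (bdd (sub_nonneg.2 hw.2) _)
      (fun t ht => mul_nonneg (sub_nonneg.2 hw.2) (mix_brLoss_nonneg hε ht _))
      (fun t ht => by rw [mix_brLoss_eq_zero hε ht, mul_zero]) fun t ht => zFun_eq hε hεg ht]
    have h0 : sSup ((fun _ : ℝ => (0 : ℝ)) '' Set.Ico 0 εg) = 0 :=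
      le_antisymm (Real.sSup_le (by rintro _ ⟨t, _, rfl⟩; exact le_rfl) le_rfl)
        (Real.sSup_nonneg (by rintro _ ⟨t, _, rfl⟩; exact le_rfl))
    rw [h0, max_eq_right]
    apply Real.sSup_nonneg
    rintro _ ⟨t, ht, rfl⟩
    rw [← zFun_eq hε hεg ht]
    exact mul_nonneg (sub_nonneg.2 hw.2) (mix_brLoss_nonneg hε ⟨hεg.trans ht.1, ht.2⟩ _)

theorem supMix_br_dp_br {ε εg : ℝ} (hε : 0 < ε) (hεg : 0 ≤ εg) (hg : εg ≤ ε) :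
    supMix (brParams ε) (supMix (dpParams ε) (supMix (brParams ε) trivialLoss)) εg
      = max (sSup (xFun ε εg '' Set.Ico 0 εg))
          (sSup ((fun t => yFun ε εg t + zFun ε εg t) '' Set.Icc εg ε)) := by
  have hv : (2 * ε, ε) ∈ validParams := dpParams_subset hε rfl
  rw [supMix_brParams, supMix_dpParams]
  refine sSup_image_Icc_split hεg hg
    (bddAbove_mix_Icc hε (mix_le_one hv (brLoss_le_one hε)) _)
    (fun t ht => mix_nonneg ⟨hε, ht⟩ (mix_nonneg hv (brLoss_nonneg hε)) _)
    (fun t ht => ?_) fun t ht => ?_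
  -- Commuting the averages at a fixed t exposes both DP outcomes under one supremum; for t < εg the
  -- second contributes nothing.
  · rw [mix_comm, mix, mix_brLoss_eq_zero hε ht, mul_zero, add_zero, xFun_eq hε hg ht]
  · rw [mix_comm, mix, yFun_eq hε hεg ht, zFun_eq hε hεg ht]

end PrivacyComp

theorem mainTheorem7 {X : Type*} (Adj : X → X → Prop)
    (hsymm : ∀ x x', Adj x x' → Adj x' x)
    (hne : ∃ x x', x ≠ x' ∧ Adj x x')
    (ε εg : ℝ) (hε : 0 < ε) (hεg : 0 ≤ εg) :
    (ε ≤ εg →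
      PrivacyComp.deltaOpt Adj (PrivacyComp.Adaptive (PrivacyComp.BR Adj ε)
          (PrivacyComp.BR Adj ε) (PrivacyComp.DP Adj ε)) εg
        = PrivacyComp.deltaOpt Adj (PrivacyComp.Adaptive (PrivacyComp.BR Adj ε)
          (PrivacyComp.DP Adj ε) (PrivacyComp.BR Adj ε)) εg
      ∧ PrivacyComp.deltaOpt Adj (PrivacyComp.Adaptive (PrivacyComp.BR Adj ε)
          (PrivacyComp.DP Adj ε) (PrivacyComp.BR Adj ε)) εg
        = PrivacyComp.deltaOpt Adj (PrivacyComp.Adaptive (PrivacyComp.DP Adj ε)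
          (PrivacyComp.BR Adj ε) (PrivacyComp.BR Adj ε)) εg)
    ∧ (εg ≤ ε →
      PrivacyComp.deltaOpt Adj (PrivacyComp.Adaptive (PrivacyComp.DP Adj ε)
          (PrivacyComp.BR Adj ε) (PrivacyComp.BR Adj ε)) εg
        = max (sSup (PrivacyComp.xFun ε εg '' Set.Ico 0 εg))
              (sSup (PrivacyComp.yFun ε εg '' Set.Icc εg ε))
          + sSup (PrivacyComp.zFun ε εg '' Set.Icc εg ε)
      ∧ PrivacyComp.deltaOpt Adj (PrivacyComp.Adaptive (PrivacyComp.BR Adj ε)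
          (PrivacyComp.DP Adj ε) (PrivacyComp.BR Adj ε)) εg
        = max (sSup (PrivacyComp.xFun ε εg '' Set.Ico 0 εg))
              (sSup ((fun t => PrivacyComp.yFun ε εg t + PrivacyComp.zFun ε εg t)
                '' Set.Icc εg ε))
      ∧ PrivacyComp.deltaOpt Adj (PrivacyComp.Adaptive (PrivacyComp.BR Adj ε)
          (PrivacyComp.BR Adj ε) (PrivacyComp.DP Adj ε)) εg
        = max (sSup (PrivacyComp.xFun ε εg '' Set.Ico 0 εg))
              (sSup ((fun t => PrivacyComp.yFun ε εg t + PrivacyComp.zFun ε εg t)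
                '' Set.Icc εg ε))) := by
  have hD := PrivacyComp.isMixtureClass_DP hsymm hε
  have hB := PrivacyComp.isMixtureClass_BR (Adj := Adj) hε
  rw [PrivacyComp.deltaOpt_adaptive hB hB hD hne, PrivacyComp.deltaOpt_adaptive hB hD hB hne,
    PrivacyComp.deltaOpt_adaptive hD hB hB hne, PrivacyComp.supMix_br_dp hε]
  refine ⟨fun h => ⟨rfl, PrivacyComp.supMix_br_dp_br_of_le hε h⟩, fun h => ⟨?_, ?_, ?_⟩⟩
  · exact PrivacyComp.supMix_dp_br_br hε hεg h
  · exact PrivacyComp.supMix_br_dp_br hε hεg h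
  · exact PrivacyComp.supMix_br_dp_br hε hεg h
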